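/- **Setting.** A *quantum oracle* is a family $\mathcal O=(\mathcal O_n)_{n\ge 0}$ in which each $\mathcal O_n$ is an arbitrary unitary operator on $n$ qubits. An *oracle circuit* $C$ acts on a witness register of $w$ qubits and on $m\ge 1$ ancilla qubits initialised to $|0\rangle$; its gates are $H$, $T=\mathrm{diag}(1,e^{i\pi/4})$, $\mathrm{CNOT}$, and, for every $k$, the application of $\mathcal O_k$ to $k$ consecutive qubits, controlled on one further qubit. For a unit vector $\psi\in(\mathbb C^2)^{\otimes w}$ let $p_C^{\mathcal O}(\psi)$ be the probability that measuring the first ancilla qubit at the end of the circuit, run on $\psi\otimes|0^m\rangle$, gives $1$. For $a\in[0,1]$ let $D_a=D_a(C,\mathcal O)$ be the largest dimension of a subspace of $(\mathbb C^2)^{\otimes w}$ all of whose unit vectors satisfy $p_C^{\mathcal O}(\psi)\ge a$. A promise problem is a pair $L=(L_{\rm yes},L_{\rm no})$ of disjoint sets of bit strings. "Polynomial time" refers to deterministic Turing machines without access to the oracle; circuits are described by lists of gates, with the numbers of qubits and the positions of the gates written in unary. * $L\in\mathsf{QMA}^{\mathcal O}$ if there is a polynomial-time computable map $x\mapsto V_x$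 from bit strings to oracle circuits such that for $x\in L_{\rm yes}$ some unit vector $\psi$ has $p_{V_x}^{\mathcal O}(\psi)\ge \frac23$, and for $x\in L_{\rm no}$ every unit vector $\psi$ has $p_{V_x}^{\mathcal O}(\psi)\le\frac13$. * *Quantum approximate counting relative to $\mathcal O$*: an instance is an oracle circuit $C$ with thresholds $b<a$ and an error parameter $\varepsilon$; a real number $D$ is a valid estimate if $(1-\varepsilon)D_a\le D\le(1+\varepsilon)D_b$. $\mathsf{QXC}^{\mathcal O}$ is the class of promise problems that can be decided in polynomial time from a valid estimate: $L\in\mathsf{QXC}^{\mathcal O}$ if there are a polynomial $p$ and a polynomial-time computable map sending $x$ to an oracle circuit $V_x$, nonnegative rational numbers $a_x,b_x,\varepsilon_x,t_x$ (numerators and denominators in binary) and a bit $s_x$, such that for all $x\in L_{\rm yes}\cup L_{\rm no}$ one has $0<b_x<a_x\le 1$, $p(|x|)\,(a_x-b_x)\ge 1$ and $p(|x|)\,\varepsilon_x\ge1$, and such that, for **every** valid estimate $D$ of the instance $(V_x,a_x,b_x,\varepsilon_x)$, the following rule answers "yes" if $x\in L_{\rm yes}$ and "no" if $x\in L_{\rm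 no}$: if $s_x=1$, answer "yes" exactly when $D\le t_x$; if $s_x=0$, answer "yes" exactly when $D>t_x$. **Corollary.** There exists a quantum oracle $\mathcal O$ such that $\mathsf{QXC}^{\mathcal O}\not\subseteq\mathsf{QMA}^{\mathcal O}$. -/

import Mathlib

noncomputable section

/-! ### Qubits, states, oracles, circuits -/

/-- Vectors of amplitudes of an `N`-qubit register, in the computational basis. -/
abbrev QState (N : ℕ) : Type := (Fin N → Bool) → ℂ

/-- `ψ` is a (normalised) pure state. -/
def QState.IsUnit {N : ℕ} (ψ : QState N) : Prop := ∑ x, ‖ψ x‖ ^ 2 = 1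

/-- A quantum oracle: for each `n`, an arbitrary unitary operation on `n` qubits. -/
abbrev QuantumOracle : Type :=
  ∀ n : ℕ, Matrix.unitaryGroup (Fin n → Bool) ℂ

/-- Gates on `N` wires. `query c s k` is a query to the `k`-qubit oracle on the consecutive wires
`s, …, s + k - 1`, controlled on wire `c` being `1` (other wires are reached by swapping, a swap
being three `cnot`s). -/
inductive Gate (N : ℕ) : Type
  | hadamard (i : Fin N) : Gate N
  | tGate (i : Fin N) : Gate N
  | cnot (c t : Fin N) (hne : c ≠ t) : Gate N
  | query (c : Fin N) (s k : ℕ) (hk : s + k ≤ N) (hc : c.val < s ∨ s + k ≤ c.val) : Gate N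

/-- The bits of `x` on the wires `s, …, s + k - 1`. -/
def readBlock {N : ℕ} (s k : ℕ) (hk : s + k ≤ N) (x : Fin N → Bool) : Fin k → Bool :=
  fun j => x ⟨s + j.val, by have := j.isLt; omega⟩

/-- Replace the bits of `x` on the wires `s, …, s + k - 1` by `z`. -/
def writeBlock {N : ℕ} (s k : ℕ) (x : Fin N → Bool) (z : Fin k → Bool) : Fin N → Bool :=
  fun i => if h : s ≤ i.val ∧ i.val < s + k then z ⟨i.val - s, by omega⟩ else x i

/-- The action of a gate on a vector of amplitudes. -/
def Gate.apply {N : ℕ} (O : QuantumOracle) : Gate N → QState N → QState N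
  | .hadamard i, ψ => fun x =>
      ((Real.sqrt 2 : ℝ) : ℂ)⁻¹ *
        (ψ (Function.update x i false) +
          (if x i then -1 else 1) * ψ (Function.update x i true))
  | .tGate i, ψ => fun x =>
      (if x i then Complex.exp (Complex.I * (Real.pi / 4 : ℝ)) else 1) * ψ x
  | .cnot c t _, ψ => fun x => ψ (Function.update x t (xor (x t) (x c)))
  | .query c s k hk _, ψ => fun x =>
      if x c then
        ∑ z : Fin k → Bool,
          (O k : Matrix (Fin k → Bool) (Fin k → Bool) ℂ) (readBlock s k hk x) z *
            ψ (writeBlock s k x z)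
      else ψ x

/-- A verification circuit with oracle gates. Wires `0, …, anc` are the `anc + 1` ancilla qubits
(wire `0` is the output), and the remaining `wit` wires hold the witness. -/
structure OracleCircuit where
  anc : ℕ
  wit : ℕ
  gates : List (Gate (anc + 1 + wit))

namespace OracleCircuit

/-- The state in which all ancillas are `|0⟩` and the witness register holds `ψ`. -/
def initState (C : OracleCircuit) (ψ : QState C.wit) : QState (C.anc + 1 + C.wit) :=
  fun x =>
    if ∀ i : Fin (C.anc + 1), x (Fin.castAdd C.wit i) = false then
      ψ (fun j => x (Fin.natAdd (C.anc + 1) j))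
    else 0

/-- The state at the end of the circuit; the gates act in the order of the list. -/
def finalState (C : OracleCircuit) (O : QuantumOracle) (ψ : QState C.wit) :
    QState (C.anc + 1 + C.wit) :=
  C.gates.foldl (fun φ g => g.apply O φ) (C.initState ψ)

/-- The probability that measuring wire `0` at the end of the circuit gives `1`. -/
def acceptProb (C : OracleCircuit) (O : QuantumOracle) (ψ : QState C.wit) : ℝ :=
  ∑ x, if x (Fin.castAdd C.wit 0) then ‖C.finalState O ψ x‖ ^ 2 else 0

/-- `D_a`: the (largest) dimension of a space of witnesses all of whose states are accepted with
probability at least `a`. -/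
def witnessDim (C : OracleCircuit) (O : QuantumOracle) (a : ℝ) : ℕ :=
  sSup {d : ℕ | ∃ W : Submodule ℂ (QState C.wit), Module.finrank ℂ W = d ∧
    ∀ ψ ∈ W, ψ.IsUnit → a ≤ C.acceptProb O ψ}

end OracleCircuit

/-! ### Descriptions as bit strings, and polynomial time -/

/-- Self-delimiting unary code of a natural number. -/
def encodeUnary (n : ℕ) : List Bool := List.replicate n true ++ [false]

/-- Self-delimiting code of a bit string. -/
def encodeBits : List Bool → List Bool
  | [] => [false]
  | b :: l => true :: b :: encodeBits l

/-- Self-delimiting binary code of a nonnegative rational number. -/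
def encodeNNRat (q : ℚ≥0) : List Bool :=
  encodeBits q.num.bits ++ encodeBits q.den.bits

/-- Code of a gate; wires are written in unary. -/
def Gate.encode {N : ℕ} : Gate N → List Bool
  | .hadamard i => [false, false] ++ encodeUnary i.val
  | .tGate i => [false, true] ++ encodeUnary i.val
  | .cnot c t _ => [true, false] ++ (encodeUnary c.val ++ encodeUnary t.val)
  | .query c s k _ _ =>
      [true, true] ++ (encodeUnary c.val ++ (encodeUnary s ++ encodeUnary k))

/-- The description of a circuit; its length is at least the number of wires and of gates. -/
def OracleCircuit.encode (C : OracleCircuit) : List Bool :=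
  encodeUnary C.anc ++ (encodeUnary C.wit ++ C.gates.flatMap Gate.encode)

/-- `f` is computable in polynomial time by a deterministic multi-stack Turing machine (all of
whose alphabets are finite), its values being written through the code `enc`. -/
def PolyTimeComputable {β : Type} (enc : β → List Bool) (f : List Bool → β) : Prop :=
  ∃ M : Turing.TM2ComputableInPolyTime (α := List Bool) (αΓ := Bool) id enc f,
    ∀ k, Finite (M.tm.Γ k)

/-! ### Complexity classes -/

/-- A promise problem over bit strings. -/
structure PromiseProblem where
  yes : Set (List Bool)
  no : Set (List Bool)
  disjoint : Disjoint yes no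

/-- `QMA` relative to the oracle `O`. -/
def QMA (O : QuantumOracle) : Set PromiseProblem :=
  {L | ∃ V : List Bool → OracleCircuit, PolyTimeComputable OracleCircuit.encode V ∧
    (∀ x ∈ L.yes, ∃ ψ : QState (V x).wit, ψ.IsUnit ∧ 2 / 3 ≤ (V x).acceptProb O ψ) ∧
    (∀ x ∈ L.no, ∀ ψ : QState (V x).wit, ψ.IsUnit → (V x).acceptProb O ψ ≤ 1 / 3)}

/-- An instance of quantum approximate counting (verifier `circ`, thresholds `b < a`, error
parameter `ε`) together with the rule by which an estimate `D` is turned into a decision: `D` is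
compared with `cut`, and `D ≤ cut` means "yes" if `small = true` and "no" if `small = false`. -/
structure CountingQuery where
  circ : OracleCircuit
  a : ℚ≥0
  b : ℚ≥0
  ε : ℚ≥0
  cut : ℚ≥0
  small : Bool

namespace CountingQuery

/-- `D` solves the approximate counting instance: `(1 - ε) D_a ≤ D ≤ (1 + ε) D_b`. -/
def IsEstimate (Q : CountingQuery) (O : QuantumOracle) (D : ℝ) : Prop :=
  (1 - (Q.ε : ℝ)) * (Q.circ.witnessDim O (Q.a : ℝ) : ℝ) ≤ D ∧
    D ≤ (1 + (Q.ε : ℝ)) * (Q.circ.witnessDim O (Q.b : ℝ) : ℝ)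

/-- The decision made from the estimate `D`. -/
def Answer (Q : CountingQuery) (D : ℝ) : Prop :=
  if Q.small then D ≤ (Q.cut : ℝ) else (Q.cut : ℝ) < D

/-- The description of a query; the rational numbers are written in binary. -/
def encode (Q : CountingQuery) : List Bool :=
  encodeNNRat Q.a ++ (encodeNNRat Q.b ++ (encodeNNRat Q.ε ++ (encodeNNRat Q.cut ++
    ([Q.small] ++ Q.circ.encode))))

end CountingQuery

/-- `QXC` relative to the oracle `O`: the promise problems that a polynomial-time algorithm decides
by means of a solution of an instance of quantum approximate counting. On input `x` it computes an
instance, with `0 < b < a ≤ 1` and with `a - b` and `ε` at least `1 / p(|x|)`, and the decision made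
from the estimate has to be right whichever valid estimate `D` of the instance is returned. -/
def QXC (O : QuantumOracle) : Set PromiseProblem :=
  {L | ∃ Q : List Bool → CountingQuery, PolyTimeComputable CountingQuery.encode Q ∧
    (∃ p : Polynomial ℕ, ∀ x ∈ L.yes ∪ L.no,
      0 < (Q x).b ∧ (Q x).b < (Q x).a ∧ (Q x).a ≤ 1 ∧
      1 ≤ ((p.eval x.length : ℕ) : ℝ) * (((Q x).a : ℝ) - ((Q x).b : ℝ)) ∧
      1 ≤ ((p.eval x.length : ℕ) : ℝ) * ((Q x).ε : ℝ)) ∧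
    (∀ x ∈ L.yes, ∀ D : ℝ, (Q x).IsEstimate O D → (Q x).Answer D) ∧
    (∀ x ∈ L.no, ∀ D : ℝ, (Q x).IsEstimate O D → ¬ (Q x).Answer D)}

/-! ### The descriptions determine what they describe -/

theorem encodeUnary_append_inj {m n : ℕ} {l l' : List Bool}
    (h : encodeUnary m ++ l = encodeUnary n ++ l') : m = n ∧ l = l' := by
  induction m generalizing n with
  | zero => cases n <;> simp_all [encodeUnary, List.replicate_succ]
  | succ m ih =>
    cases n with
    | zero => simp [encodeUnary, List.replicate_succ] at h
    | succ n =>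
      have := @ih n (by simpa [encodeUnary, List.replicate_succ] using h)
      simpa using this

theorem encodeBits_append_inj {u v l l' : List Bool}
    (h : encodeBits u ++ l = encodeBits v ++ l') : u = v ∧ l = l' := by
  induction u generalizing v with
  | nil => cases v <;> simp_all [encodeBits]
  | cons b u ih =>
    cases v with
    | nil => simp [encodeBits] at h
    | cons c v =>
      simp only [encodeBits, List.cons_append, List.cons.injEq, true_and] at h
      obtain ⟨h1, h2⟩ := ih h.2
      exact ⟨by rw [h.1, h1], h2⟩

theorem natBits_inj {m n : ℕ} (h : m.bits = n.bits) : m = n := by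
  have key : ∀ i, m.testBit i = n.testBit i := by
    intro i
    rw [Nat.testBit_eq_inth, Nat.testBit_eq_inth, h]
  exact Nat.eq_of_testBit_eq key

theorem encodeNNRat_append_inj {p q : ℚ≥0} {l l' : List Bool}
    (h : encodeNNRat p ++ l = encodeNNRat q ++ l') : p = q ∧ l = l' := by
  simp only [encodeNNRat, List.append_assoc] at h
  obtain ⟨h1, h2⟩ := encodeBits_append_inj h
  obtain ⟨h3, h4⟩ := encodeBits_append_inj h2
  exact ⟨NNRat.ext_num_den (natBits_inj h1) (natBits_inj h3), h4⟩

theorem Gate.encode_append_inj {N : ℕ} {g g' : Gate N} {l l' : List Bool}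
    (h : g.encode ++ l = g'.encode ++ l') : g = g' ∧ l = l' := by
  cases g <;> cases g' <;>
    simp only [Gate.encode, List.append_assoc, List.cons_append, List.nil_append,
      List.cons.injEq, true_and, false_and, and_false, reduceCtorEq] at h
  · obtain ⟨h1, h2⟩ := encodeUnary_append_inj h
    exact ⟨by rw [Fin.ext h1], h2⟩
  · obtain ⟨h1, h2⟩ := encodeUnary_append_inj h
    exact ⟨by rw [Fin.ext h1], h2⟩
  · obtain ⟨h1, h2⟩ := encodeUnary_append_inj h
    obtain ⟨h3, h4⟩ := encodeUnary_append_inj h2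
    exact ⟨by simp [Fin.ext h1, Fin.ext h3], h4⟩
  · obtain ⟨h1, h2⟩ := encodeUnary_append_inj h
    obtain ⟨h3, h4⟩ := encodeUnary_append_inj h2
    obtain ⟨h5, h6⟩ := encodeUnary_append_inj h4
    exact ⟨by simp [Fin.ext h1, h3, h5], h6⟩

theorem Gate.encode_ne_nil {N : ℕ} (g : Gate N) : g.encode ≠ [] := by
  cases g <;> simp [Gate.encode]

theorem Gate.flatMap_encode_injective {N : ℕ} {u v : List (Gate N)}
    (h : u.flatMap Gate.encode = v.flatMap Gate.encode) : u = v := by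
  induction u generalizing v with
  | nil =>
    cases v with
    | nil => rfl
    | cons g v => simp [Gate.encode_ne_nil] at h
  | cons g u ih =>
    cases v with
    | nil => simp [Gate.encode_ne_nil] at h
    | cons g' v =>
      simp only [List.flatMap_cons] at h
      obtain ⟨h1, h2⟩ := Gate.encode_append_inj h
      rw [h1, ih h2]

theorem OracleCircuit.encode_injective : Function.Injective OracleCircuit.encode := by
  rintro ⟨a, w, g⟩ ⟨a', w', g'⟩ h
  simp only [OracleCircuit.encode] at h
  obtain ⟨h1, h2⟩ := encodeUnary_append_inj h
  obtain ⟨h3, h4⟩ := encodeUnary_append_inj h2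
  subst h1 h3
  rw [Gate.flatMap_encode_injective h4]

theorem CountingQuery.encode_injective : Function.Injective CountingQuery.encode := by
  rintro ⟨C, a, b, e, t, s⟩ ⟨C', a', b', e', t', s'⟩ h
  simp only [CountingQuery.encode] at h
  obtain ⟨h1, h⟩ := encodeNNRat_append_inj h
  obtain ⟨h2, h⟩ := encodeNNRat_append_inj h
  obtain ⟨h3, h⟩ := encodeNNRat_append_inj h
  obtain ⟨h4, h⟩ := encodeNNRat_append_inj h
  simp only [List.cons_append, List.nil_append, List.cons.injEq] at h
  rw [h1, h2, h3, h4, h.1, OracleCircuit.encode_injective h.2]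

end

/-! ### Gates preserve norms -/

/-! Take oracles that, on each number `n` of qubits, are either the identity or the sign flip of a
single basis state `y`, and ask on inputs of length `n` whether the identity occurs ("yes") or a
flip ("no"). A quantum witness could exhibit a flip, but its absence is hard to certify, while
counting decides both cases.

Counting: Hadamard, controlled query, Hadamard on one ancilla accepts `ψ` with probability `0` for
the identity and `‖ψ y‖²` for the flip. So either `D_{1/2} = 0`, which forces `D ≤ 0`, or `D_1 ≥ 1`,
which forces `D ≥ 1/2` when `ε = 1/2`. That this instance can be written down in polynomial time is
shown by an explicit machine (`LengthWriter`).

No QMA verifier: suppose a circuit with `G` gates accepts `ψ` with probability at least `2/3` when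
`O n = 1`. By a hybrid argument (`sum_nrm_sq_runGates_flip_sub_le`), the squared displacements of
the final state, summed over all `2 ^ n` flips, are at most `4 G (G + 1)`. If `2 ^ n > 144 G (G +
1)`, some flip moves the state so little that the same `ψ` is still accepted with probability above
`1/3`, which is wrong for a "no" instance (`exists_flip_acceptProb_gt`).

One oracle against all verifiers: failure of a given verifier depends on a finite part of the oracle
and can be enforced beyond any finite part, so it is an open dense condition and the Baire category
theorem applies. This needs only countably many verifiers (`countable_setOf_polyTimeComputable`) and
polynomially many gates in each circuit (`PolyTimeComputable.exists_length_le`). -/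

theorem readBlock_writeBlock {N : ℕ} (s k : ℕ) (hk : s + k ≤ N) (x : Fin N → Bool)
    (z : Fin k → Bool) : readBlock s k hk (writeBlock s k x z) = z := by
  funext j
  have := j.isLt
  simp only [readBlock, writeBlock]
  rw [dif_pos (by omega)]
  congr 1
  ext
  simp

theorem writeBlock_writeBlock {N : ℕ} (s k : ℕ) (x : Fin N → Bool) (z w : Fin k → Bool) :
    writeBlock s k (writeBlock s k x z) w = writeBlock s k x w := by
  funext i
  simp only [writeBlock]
  split_ifs <;> rfl

theorem writeBlock_readBlock {N : ℕ} (s k : ℕ) (hk : s + k ≤ N) (x : Fin N → Bool) :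
    writeBlock s k x (readBlock s k hk x) = x := by
  funext i
  simp only [writeBlock, readBlock]
  split_ifs with h
  · congr 1
    ext
    simp only
    omega
  · rfl

theorem writeBlock_apply_of_notMem {N : ℕ} {s k : ℕ} (x : Fin N → Bool) (z : Fin k → Bool)
    {c : Fin N} (hc : c.val < s ∨ s + k ≤ c.val) : writeBlock s k x z c = x c := by
  simp only [writeBlock]
  rw [dif_neg (by omega)]

/-- Writing a block and remembering what it replaced is an involution, so the average over the
contents of a block does not change the sum over all basis states. -/
theorem sum_sum_writeBlock {N : ℕ} (s k : ℕ) (hk : s + k ≤ N) (h : (Fin N → Bool) → ℝ) :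
    ∑ x, ∑ z : Fin k → Bool, h (writeBlock s k x z) = 2 ^ k * ∑ x, h x := by
  let e : (Fin N → Bool) × (Fin k → Bool) → (Fin N → Bool) × (Fin k → Bool) :=
    fun p => (writeBlock s k p.1 p.2, readBlock s k hk p.1)
  have he : Function.Involutive e := by
    rintro ⟨x, z⟩
    simp only [e, writeBlock_writeBlock, writeBlock_readBlock, readBlock_writeBlock]
  have h1 := Equiv.sum_comp he.toPerm (fun p => h p.1)
  simp only [Fintype.sum_prod_type, Finset.sum_const, Finset.card_univ] at h1
  rw [Finset.mul_sum]
  simpa [e] using h1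

theorem sum_update_add_update {N : ℕ} (i : Fin N) (h : (Fin N → Bool) → ℝ) :
    ∑ x, (h (Function.update x i false) + h (Function.update x i true)) = 2 * ∑ x, h x := by
  -- Exchanging bit `i` with a stored bit is an involution, as for blocks above.
  let e : (Fin N → Bool) × Bool → (Fin N → Bool) × Bool :=
    fun p => (Function.update p.1 i p.2, p.1 i)
  have he : Function.Involutive e := by
    rintro ⟨x, z⟩
    simp [e]
  have h1 := Equiv.sum_comp he.toPerm (fun p => h p.1)
  simp only [Fintype.sum_prod_type, Finset.sum_const, Finset.card_univ] at h1
  rw [Finset.mul_sum]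
  simpa [e, add_comm] using h1

theorem sum_norm_sq_unitary_mulVec {ι : Type*} [Fintype ι] [DecidableEq ι]
    (U : Matrix.unitaryGroup ι ℂ) (v : ι → ℂ) :
    ∑ z, ‖∑ w, (U : Matrix ι ι ℂ) z w * v w‖ ^ 2 = ∑ z, ‖v z‖ ^ 2 := by
  have key : ∀ u : ι → ℂ, ((∑ z, ‖u z‖ ^ 2 : ℝ) : ℂ) = star u ⬝ᵥ u := by
    intro u
    simp [dotProduct, Complex.conj_mul']
  have h : star ((U : Matrix ι ι ℂ).mulVec v) ⬝ᵥ ((U : Matrix ι ι ℂ).mulVec v) = star v ⬝ᵥ v := by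
    rw [Matrix.star_mulVec, Matrix.dotProduct_mulVec, Matrix.vecMul_vecMul,
      ← Matrix.star_eq_conjTranspose, Matrix.UnitaryGroup.star_mul_self, Matrix.vecMul_one]
  rw [← key, ← key] at h
  exact_mod_cast h

theorem norm_hadamard_sq (a b : ℂ) :
    ‖((Real.sqrt 2 : ℝ) : ℂ)⁻¹ * (a + 1 * b)‖ ^ 2 +
      ‖((Real.sqrt 2 : ℝ) : ℂ)⁻¹ * (a + -1 * b)‖ ^ 2 = ‖a‖ ^ 2 + ‖b‖ ^ 2 := by
  have h2 : ‖((Real.sqrt 2 : ℝ) : ℂ)⁻¹‖ ^ 2 = 1 / 2 := by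
    rw [norm_inv, Complex.norm_real, Real.norm_of_nonneg (Real.sqrt_nonneg 2), inv_pow,
      Real.sq_sqrt (by norm_num)]
    norm_num
  have hp := parallelogram_law_with_norm ℝ a b
  rw [norm_mul, norm_mul, mul_pow, mul_pow, h2, one_mul, neg_one_mul, ← sub_eq_add_neg]
  linarith

/-- Each gate either permutes basis states, multiplies amplitudes by phases, or acts unitarily
within the fibres obtained by varying one bit or one block. In the last case the averaging
identities reduce the claim to a single fibre. -/
theorem Gate.sum_norm_sq_apply {N : ℕ} (O : QuantumOracle) (g : Gate N) (ψ : QState N) :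
    ∑ x, ‖g.apply O ψ x‖ ^ 2 = ∑ x, ‖ψ x‖ ^ 2 := by
  cases g with
  | hadamard i =>
    have h1 := sum_update_add_update i (fun x => ‖(Gate.hadamard i).apply O ψ x‖ ^ 2)
    have h2 := sum_update_add_update i (fun x => ‖ψ x‖ ^ 2)
    have : ∀ x : Fin N → Bool,
        ‖(Gate.hadamard i).apply O ψ (Function.update x i false)‖ ^ 2 +
          ‖(Gate.hadamard i).apply O ψ (Function.update x i true)‖ ^ 2 =
        ‖ψ (Function.update x i false)‖ ^ 2 + ‖ψ (Function.update x i true)‖ ^ 2 := by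
      intro x
      have := norm_hadamard_sq (ψ (Function.update x i false)) (ψ (Function.update x i true))
      simpa [Gate.apply] using this
    simp only [this] at h1
    linarith
  | tGate i =>
    refine Finset.sum_congr rfl fun x _ => ?_
    have : ‖Complex.exp (Complex.I * (Real.pi / 4 : ℝ))‖ = 1 := by
      rw [mul_comm]
      exact Complex.norm_exp_ofReal_mul_I _
    simp only [Gate.apply, norm_mul]
    split_ifs
    · rw [this, one_mul]
    · simp
  | cnot c t hne =>
    let e : (Fin N → Bool) → (Fin N → Bool) := fun x => Function.update x t (xor (x t) (x c))
    have he : Function.Involutive e := by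
      intro x
      simp [e, Function.update_of_ne hne]
    exact Equiv.sum_comp he.toPerm (fun x => ‖ψ x‖ ^ 2)
  | query c s k hk hc =>
    have h1 := sum_sum_writeBlock s k hk (fun x => ‖(Gate.query c s k hk hc).apply O ψ x‖ ^ 2)
    have h2 := sum_sum_writeBlock s k hk (fun x => ‖ψ x‖ ^ 2)
    have : ∀ x : Fin N → Bool,
        ∑ z, ‖(Gate.query c s k hk hc).apply O ψ (writeBlock s k x z)‖ ^ 2 =
          ∑ z, ‖ψ (writeBlock s k x z)‖ ^ 2 := by
      intro x
      simp only [Gate.apply, writeBlock_apply_of_notMem x _ hc, readBlock_writeBlock,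
        writeBlock_writeBlock]
      split_ifs
      · exact sum_norm_sq_unitary_mulVec (O k) (fun z => ψ (writeBlock s k x z))
      · rfl
    simp only [this] at h1
    exact mul_left_cancel₀ (by positivity) (h1.symm.trans h2)

theorem Gate.apply_sub {N : ℕ} (O : QuantumOracle) (g : Gate N) (φ ψ : QState N) :
    g.apply O (φ - ψ) = g.apply O φ - g.apply O ψ := by
  funext x
  cases g with
  | hadamard i => simp only [Gate.apply, Pi.sub_apply]; ring
  | tGate i => simp only [Gate.apply, Pi.sub_apply]; ring
  | cnot c t hne => rfl
  | query c s k hk hc =>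
    simp only [Gate.apply, Pi.sub_apply]
    split_ifs
    · simp [mul_sub]
    · rfl

/-! ### Running a list of gates -/

/-- The `ℓ²` norm of a vector of amplitudes. -/
noncomputable def QState.nrm {N : ℕ} (ψ : QState N) : ℝ :=
  ‖(WithLp.toLp 2 ψ : EuclideanSpace ℂ (Fin N → Bool))‖

theorem QState.nrm_sq {N : ℕ} (ψ : QState N) : ψ.nrm ^ 2 = ∑ x, ‖ψ x‖ ^ 2 := by
  simp [QState.nrm, EuclideanSpace.norm_sq_eq]

theorem QState.nrm_nonneg {N : ℕ} (ψ : QState N) : 0 ≤ ψ.nrm := norm_nonneg _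

theorem QState.nrm_add_le {N : ℕ} (φ ψ : QState N) :
    QState.nrm (φ + ψ) ≤ φ.nrm + ψ.nrm := by
  simp only [QState.nrm, WithLp.toLp_add]
  exact norm_add_le _ _

theorem Gate.nrm_apply {N : ℕ} (O : QuantumOracle) (g : Gate N) (ψ : QState N) :
    QState.nrm (g.apply O ψ) = ψ.nrm := by
  rw [← sq_eq_sq₀ (QState.nrm_nonneg _) (QState.nrm_nonneg _), QState.nrm_sq, QState.nrm_sq,
    Gate.sum_norm_sq_apply]

/-- The action of a list of gates. -/
noncomputable def runGates {N : ℕ} (O : QuantumOracle) (gs : List (Gate N)) (ψ : QState N) : QState N :=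
  gs.foldl (fun φ g => g.apply O φ) ψ

theorem runGates_cons {N : ℕ} (O : QuantumOracle) (g : Gate N) (gs : List (Gate N))
    (ψ : QState N) : runGates O (g :: gs) ψ = runGates O gs (g.apply O ψ) := rfl

theorem nrm_runGates {N : ℕ} (O : QuantumOracle) (gs : List (Gate N)) (ψ : QState N) :
    QState.nrm (runGates O gs ψ) = ψ.nrm := by
  induction gs generalizing ψ with
  | nil => rfl
  | cons g gs ih => rw [runGates_cons, ih, Gate.nrm_apply]

theorem runGates_sub {N : ℕ} (O : QuantumOracle) (gs : List (Gate N)) (φ ψ : QState N) :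
    runGates O gs (φ - ψ) = runGates O gs φ - runGates O gs ψ := by
  induction gs generalizing φ ψ with
  | nil => rfl
  | cons g gs ih => rw [runGates_cons, Gate.apply_sub, ih]; rfl

/-! ### Locality -/

/-- A query to `O k` occupies `k` wires, so a gate on `N` wires never sees `O k` for `k > N`. -/
theorem Gate.apply_congr {N : ℕ} {O O' : QuantumOracle} (h : ∀ k ≤ N, O k = O' k) (g : Gate N)
    (ψ : QState N) : g.apply O ψ = g.apply O' ψ := by
  cases g with
  | query c s k hk hc =>
    funext x
    simp only [Gate.apply, h k (by omega)]
  | _ => rfl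

theorem OracleCircuit.acceptProb_congr (C : OracleCircuit) {O O' : QuantumOracle}
    (h : ∀ k ≤ C.anc + 1 + C.wit, O k = O' k) (ψ : QState C.wit) :
    C.acceptProb O ψ = C.acceptProb O' ψ := by
  have : ∀ g : Gate (C.anc + 1 + C.wit), g.apply O = g.apply O' := fun g =>
    funext fun φ => Gate.apply_congr h g φ
  simp only [OracleCircuit.acceptProb, OracleCircuit.finalState, this]

/-! ### Phase flips -/

/-- The unitary operation that changes the sign of the basis state `y`. -/
def phaseFlip {n : ℕ} (y : Fin n → Bool) : Matrix.unitaryGroup (Fin n → Bool) ℂ :=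
  ⟨Matrix.diagonal fun x => if x = y then -1 else 1, by
    rw [Matrix.mem_unitaryGroup_iff, Matrix.star_eq_conjTranspose, Matrix.diagonal_conjTranspose,
      Matrix.diagonal_mul_diagonal, ← Matrix.diagonal_one]
    congr 1
    funext x
    simp only [Pi.star_apply]
    split_ifs <;> simp⟩

theorem sum_one_mul_writeBlock {N : ℕ} (s k : ℕ) (hk : s + k ≤ N) (ψ : QState N)
    (x : Fin N → Bool) :
    ∑ z, ((1 : Matrix.unitaryGroup (Fin k → Bool) ℂ) : Matrix (Fin k → Bool) (Fin k → Bool) ℂ)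
      (readBlock s k hk x) z * ψ (writeBlock s k x z) = ψ x := by
  simp [Matrix.one_apply, writeBlock_readBlock]

theorem sum_phaseFlip_mul_writeBlock {N : ℕ} (s k : ℕ) (hk : s + k ≤ N) (ψ : QState N)
    (y : Fin k → Bool) (x : Fin N → Bool) :
    ∑ z, (phaseFlip y : Matrix (Fin k → Bool) (Fin k → Bool) ℂ)
      (readBlock s k hk x) z * ψ (writeBlock s k x z) =
        if readBlock s k hk x = y then -ψ x else ψ x := by
  simp only [phaseFlip, Matrix.diagonal_apply, ite_mul, zero_mul, Finset.sum_ite_eq,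
    Finset.mem_univ, if_true, writeBlock_readBlock]
  split_ifs <;> simp

/-! ### The hybrid argument -/

/-- At a basis state `x` whose control bit is set, only the flip at the block content of `x` changes
the amplitude, by `-2 ψ x`. Hence all flips together cost at most four times the mass of `ψ`,
however many there are. -/
theorem Gate.sum_nrm_sq_apply_flip_sub_le {N : ℕ} (O : QuantumOracle) (n : ℕ) (hO : O n = 1)
    (g : Gate N) (ψ : QState N) :
    ∑ y : Fin n → Bool,
      QState.nrm (g.apply (Function.update O n (phaseFlip y)) ψ - g.apply O ψ) ^ 2 ≤
        4 * ψ.nrm ^ 2 := by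
  have triv : ∀ u : (Fin n → Bool) → QState N, (∀ y, u y = 0) →
      ∑ y : Fin n → Bool, (u y).nrm ^ 2 ≤ 4 * ψ.nrm ^ 2 := by
    intro u hu
    simp only [hu]
    have : (0 : QState N).nrm = 0 := by simp [QState.nrm]
    simp only [this]
    simp
    positivity
  cases g with
  | query c s k hk hc =>
    by_cases hkn : k = n
    · subst hkn
      simp only [QState.nrm_sq]
      rw [Finset.sum_comm, Finset.mul_sum]
      refine Finset.sum_le_sum fun x _ => ?_
      simp only [Gate.apply, Function.update_self, hO, Pi.sub_apply, sum_one_mul_writeBlock,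
        sum_phaseFlip_mul_writeBlock]
      by_cases hx : x c
      · simp only [hx, if_true]
        rw [Finset.sum_eq_single (readBlock s k hk x)]
        · simp only [if_true]
          have : -ψ x - ψ x = -(2 * ψ x) := by ring
          rw [this, norm_neg, norm_mul, mul_pow]
          norm_num
        · intro y _ hy
          rw [if_neg (Ne.symm hy)]
          simp
        · simp
      · simp [hx]
    · refine triv _ fun y => ?_
      funext x
      simp [Gate.apply, Function.update_of_ne hkn]
  | hadamard i => exact triv _ fun y => sub_self _
  | tGate i => exact triv _ fun y => sub_self _
  | cnot c t hne => exact triv _ fun y => sub_self _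

theorem sum_nrm_sq_runGates_flip_sub_le {N : ℕ} (O : QuantumOracle) (n : ℕ) (hO : O n = 1)
    (gs : List (Gate N)) (ψ : QState N) :
    ∑ y : Fin n → Bool,
      QState.nrm (runGates (Function.update O n (phaseFlip y)) gs ψ - runGates O gs ψ) ^ 2 ≤
        4 * (gs.length * (gs.length + 1)) * ψ.nrm ^ 2 := by
  induction gs generalizing ψ with
  | nil =>
    have : (0 : QState N).nrm = 0 := by simp [QState.nrm]
    simp [runGates, this]
  | cons g gs ih =>
    set G : ℝ := (gs.length : ℝ) with hG
    have hG0 : 0 ≤ G := Nat.cast_nonneg _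
    have h1 := Gate.sum_nrm_sq_apply_flip_sub_le O n hO g ψ
    have h2 := ih (g.apply O ψ)
    rw [Gate.nrm_apply] at h2
    -- Weighted form of `(a + b)²`: the right side minus `(G + 1)(a + b)²` equals `((G + 1) a -
    -- b)²`. These weights make the recursion close exactly at `4 G (G + 1)`.
    have step : ∀ y : Fin n → Bool,
        (G + 1) * QState.nrm (runGates (Function.update O n (phaseFlip y)) (g :: gs) ψ -
          runGates O (g :: gs) ψ) ^ 2 ≤
        (G + 2) * (G + 1) *
          QState.nrm (g.apply (Function.update O n (phaseFlip y)) ψ - g.apply O ψ) ^ 2 +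
        (G + 2) * QState.nrm (runGates (Function.update O n (phaseFlip y)) gs (g.apply O ψ) -
          runGates O gs (g.apply O ψ)) ^ 2 := by
      intro y
      set O' := Function.update O n (phaseFlip y)
      set a := QState.nrm (g.apply O' ψ - g.apply O ψ) with ha
      set b := QState.nrm (runGates O' gs (g.apply O ψ) - runGates O gs (g.apply O ψ))
      have hle : QState.nrm (runGates O' (g :: gs) ψ - runGates O (g :: gs) ψ) ≤ a + b := by
        -- Hybrid step: the error made by the first gate is carried along isometrically by the
        -- flipped oracle, and the remaining error starts from the unperturbed state, to which the
        -- induction hypothesis applies.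
        have : runGates O' (g :: gs) ψ - runGates O (g :: gs) ψ =
            runGates O' gs (g.apply O' ψ - g.apply O ψ) +
              (runGates O' gs (g.apply O ψ) - runGates O gs (g.apply O ψ)) := by
          rw [runGates_cons, runGates_cons, runGates_sub]
          abel
        rw [this, ha, ← nrm_runGates O' gs (g.apply O' ψ - g.apply O ψ)]
        exact QState.nrm_add_le _ _
      have hsq := pow_le_pow_left₀ (QState.nrm_nonneg _) hle 2
      calc _ ≤ (G + 1) * (a + b) ^ 2 := by gcongr
        _ ≤ _ := by nlinarith [sq_nonneg ((G + 1) * a - b)]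
    have hsum := Finset.sum_le_sum fun y (_ : y ∈ Finset.univ) => step y
    rw [← Finset.mul_sum, Finset.sum_add_distrib, ← Finset.mul_sum, ← Finset.mul_sum] at hsum
    have hlen : (((g :: gs).length : ℕ) : ℝ) = G + 1 := by simp [hG]
    rw [hlen]
    refine le_of_mul_le_mul_left (hsum.trans ?_) (by positivity : 0 < G + 1)
    calc _ ≤ (G + 2) * (G + 1) * (4 * ψ.nrm ^ 2) +
          (G + 2) * (4 * (G * (G + 1)) * ψ.nrm ^ 2) := by gcongr
      _ = _ := by ring

/-! ### Acceptance probabilities -/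

namespace OracleCircuit

theorem nrm_initState (C : OracleCircuit) (ψ : QState C.wit) :
    QState.nrm (C.initState ψ) = ψ.nrm := by
  rw [← sq_eq_sq₀ (QState.nrm_nonneg _) (QState.nrm_nonneg _), QState.nrm_sq, QState.nrm_sq]
  rw [← (Fin.appendEquiv (α := Bool) (C.anc + 1) C.wit).sum_comp, Fintype.sum_prod_type]
  rw [Finset.sum_eq_single (fun _ => false)]
  · simp [initState, Fin.appendEquiv]
  · intro u _ hu
    refine Finset.sum_eq_zero fun v _ => ?_
    have : ¬ ∀ i, u i = false := fun h => hu (funext h)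
    simp only [initState, Fin.appendEquiv, Equiv.coe_fn_mk, Fin.append_left, if_neg this]
    simp
  · simp

theorem acceptProb_sub_le (C : OracleCircuit) (O O' : QuantumOracle) (ψ : QState C.wit)
    (hψ : ψ.IsUnit) :
    C.acceptProb O ψ - 2 * QState.nrm (C.finalState O' ψ - C.finalState O ψ) ≤
      C.acceptProb O' ψ := by
  let P : QState (C.anc + 1 + C.wit) → QState (C.anc + 1 + C.wit) :=
    fun φ x => if x (Fin.castAdd C.wit 0) then φ x else 0
  have hP : ∀ O, C.acceptProb O ψ = QState.nrm (P (C.finalState O ψ)) ^ 2 := by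
    intro O
    rw [QState.nrm_sq]
    refine Finset.sum_congr rfl fun x _ => ?_
    simp only [P]
    split_ifs <;> simp
  have hPle : ∀ φ, QState.nrm (P φ) ≤ QState.nrm φ := by
    intro φ
    rw [← sq_le_sq₀ (QState.nrm_nonneg _) (QState.nrm_nonneg _), QState.nrm_sq, QState.nrm_sq]
    refine Finset.sum_le_sum fun x _ => ?_
    simp only [P]
    split_ifs <;> simp
  have hone : ∀ O, QState.nrm (C.finalState O ψ) = 1 := by
    intro O
    have : QState.nrm (C.finalState O ψ) = ψ.nrm :=
      (nrm_runGates O C.gates (C.initState ψ)).trans (C.nrm_initState ψ)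
    rw [this, ← sq_eq_sq₀ (QState.nrm_nonneg _) zero_le_one, QState.nrm_sq, hψ, one_pow]
  set u := C.finalState O ψ
  set v := C.finalState O' ψ
  have htri : QState.nrm (P u) ≤ QState.nrm (P v) + QState.nrm (v - u) := by
    have h1 : P u = P v + P (u - v) := by
      funext x
      simp only [P, Pi.add_apply, Pi.sub_apply]
      split_ifs <;> ring
    have h2 : QState.nrm (u - v) = QState.nrm (v - u) := by
      simp only [QState.nrm, WithLp.toLp_sub]
      exact norm_sub_rev _ _
    rw [h1, ← h2]
    exact (QState.nrm_add_le _ _).trans (by gcongr; exact hPle _)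
  rw [hP O, hP O']
  have hu := (hPle u).trans (hone O).le
  have hv := (hPle v).trans (hone O').le
  have h0 := QState.nrm_nonneg (P u)
  have h1 := QState.nrm_nonneg (P v)
  have h2 := QState.nrm_nonneg (v - u)
  -- `‖P u‖² - ‖P v‖²` factors as a difference, at most `‖v - u‖`, times a sum, at most `2`.
  nlinarith

/-- A circuit with few gates cannot detect every phase flip on `n` qubits. -/
theorem exists_flip_acceptProb_gt (C : OracleCircuit) (O : QuantumOracle) (n : ℕ) (hO : O n = 1)
    (ψ : QState C.wit) (hψ : ψ.IsUnit) (hacc : 2 / 3 ≤ C.acceptProb O ψ)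
    (hn : 144 * (C.gates.length * (C.gates.length + 1)) < 2 ^ n) :
    ∃ y : Fin n → Bool, 1 / 3 < C.acceptProb (Function.update O n (phaseFlip y)) ψ := by
  by_contra! hcon
  have h1 := sum_nrm_sq_runGates_flip_sub_le O n hO C.gates (C.initState ψ)
  have hψ' : (C.initState ψ).nrm ^ 2 = 1 := by rw [C.nrm_initState, QState.nrm_sq, hψ]
  -- A drop in acceptance from `2/3` to `1/3` needs a displacement of at least `1/6`. Summing `1/36`
  -- over all `y` against `4 G (G + 1)` gives the constant `144`.
  have h2 : ∀ y : Fin n → Bool, (1 / 36 : ℝ) ≤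
      QState.nrm (runGates (Function.update O n (phaseFlip y)) C.gates (C.initState ψ) -
        runGates O C.gates (C.initState ψ)) ^ 2 := by
    intro y
    have h3 := C.acceptProb_sub_le O (Function.update O n (phaseFlip y)) ψ hψ
    have h4 := hcon y
    have h5 : (1 / 6 : ℝ) ≤ QState.nrm (C.finalState (Function.update O n (phaseFlip y)) ψ -
      C.finalState O ψ) := by linarith
    calc (1 / 36 : ℝ) = (1 / 6) ^ 2 := by norm_num
      _ ≤ _ := pow_le_pow_left₀ (by norm_num) h5 2
  have h3 := Finset.sum_le_sum fun y (_ : y ∈ Finset.univ) => h2 y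
  have hcard : (Finset.univ : Finset (Fin n → Bool)).card = 2 ^ n := by simp
  rw [Finset.sum_const, hcard, nsmul_eq_mul] at h3
  rw [hψ', mul_one] at h1
  have h4 : (144 * (C.gates.length * (C.gates.length + 1)) : ℝ) < 2 ^ n := by exact_mod_cast hn
  push_cast at h3
  linarith

end OracleCircuit

/-! ### Counting detects phase flips -/

/-- The circuit that accepts a basis state according to the sign it acquires from the oracle on
`n` qubits. -/
abbrev flipTester (n : ℕ) : OracleCircuit where
  anc := 0
  wit := n
  gates := [.hadamard 0, .query 0 1 n (by omega) (Or.inl (by simp)), .hadamard 0]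

theorem Gate.apply_query_of_eq_diagonal {N : ℕ} {O : QuantumOracle} (c : Fin N) (s k : ℕ)
    (hk : s + k ≤ N) (hc : c.val < s ∨ s + k ≤ c.val) {d : (Fin k → Bool) → ℂ}
    (hO : (O k : Matrix (Fin k → Bool) (Fin k → Bool) ℂ) = Matrix.diagonal d) (φ : QState N) :
    (Gate.query c s k hk hc).apply O φ =
      fun x => (if x c then d (readBlock s k hk x) else 1) * φ x := by
  funext x
  simp only [Gate.apply]
  split_ifs
  · simp [hO, Matrix.diagonal_apply, writeBlock_readBlock]
  · rw [one_mul]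

theorem update_append_zero (n : ℕ) (u : Fin (0 + 1) → Bool) (w : Fin n → Bool) (b : Bool) :
    Function.update (Fin.append u w) (0 : Fin (0 + 1 + n)) b = Fin.append (fun _ => b) w := by
  funext i
  refine Fin.addCases (fun j => ?_) (fun j => ?_) i
  · have : Fin.castAdd n j = 0 := by ext; simp
    rw [Fin.append_left, this, Function.update_self]
  · have : Fin.natAdd (0 + 1) j ≠ 0 := by intro h; simpa using congrArg Fin.val h
    rw [Fin.append_right, Function.update_of_ne this, Fin.append_right]

theorem readBlock_append (n : ℕ) (u : Fin (0 + 1) → Bool) (w : Fin n → Bool)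
    (h : 1 + n ≤ 0 + 1 + n) : readBlock 1 n h (Fin.append u w) = w := by
  funext j
  have : (⟨1 + j.val, by omega⟩ : Fin (0 + 1 + n)) = Fin.natAdd (0 + 1) j := by ext; simp
  simp only [readBlock]
  rw [this, Fin.append_right]

theorem append_zero (n : ℕ) (u : Fin (0 + 1) → Bool) (w : Fin n → Bool) :
    Fin.append u w (0 : Fin (0 + 1 + n)) = u 0 :=
  Fin.append_left u w 0

/-- Interference of the two branches of a controlled query to a diagonal oracle. -/
theorem apply_hadamard_query_hadamard (n : ℕ) (O : QuantumOracle) (d : (Fin n → Bool) → ℂ)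
    (hO : (O n : Matrix (Fin n → Bool) (Fin n → Bool) ℂ) = Matrix.diagonal d) (ψ : QState n)
    (φ : QState (0 + 1 + n)) (hφ : ∀ u w, φ (Fin.append u w) = if u 0 then 0 else ψ w)
    (hk : 1 + n ≤ 0 + 1 + n)
    (hc : (0 : Fin (0 + 1 + n)).val < 1 ∨ 1 + n ≤ (0 : Fin (0 + 1 + n)).val)
    (w : Fin n → Bool) :
    Gate.apply O (.hadamard 0) (Gate.apply O (.query 0 1 n hk hc)
      (Gate.apply O (.hadamard 0) φ)) (Fin.append (fun _ => true) w) = (1 - d w) / 2 * ψ w := by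
  have hs : ((Real.sqrt 2 : ℝ) : ℂ)⁻¹ * ((Real.sqrt 2 : ℝ) : ℂ)⁻¹ = 1 / 2 := by
    rw [← mul_inv, ← Complex.ofReal_mul, Real.mul_self_sqrt (by norm_num)]
    norm_num
  rw [Gate.apply_query_of_eq_diagonal _ _ _ _ _ hO]
  simp only [Gate.apply, update_append_zero, hφ, readBlock_append, append_zero, if_true,
    Bool.false_eq_true, if_false, mul_zero, add_zero]
  linear_combination (ψ w - d w * ψ w) * hs

theorem acceptProb_flipTester (n : ℕ) (O : QuantumOracle) (d : (Fin n → Bool) → ℂ)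
    (hO : (O n : Matrix (Fin n → Bool) (Fin n → Bool) ℂ) = Matrix.diagonal d) (ψ : QState n) :
    (flipTester n).acceptProb O ψ = ∑ w, ‖(1 - d w) / 2 * ψ w‖ ^ 2 := by
  have hinit : ∀ (u : Fin (0 + 1) → Bool) (w : Fin n → Bool),
      (flipTester n).initState ψ (Fin.append u w) = if u 0 then 0 else ψ w := by
    intro u w
    simp only [OracleCircuit.initState, Fin.append_left, Fin.append_right]
    cases h : u 0 <;> simp [Fin.forall_fin_one, h]
  have hfinal : ∀ w : Fin n → Bool,
      (flipTester n).finalState O ψ (Fin.append (fun _ : Fin (0 + 1) => true) w) =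
        (1 - d w) / 2 * ψ w :=
    apply_hadamard_query_hadamard n O d hO ψ _ hinit _ _
  unfold OracleCircuit.acceptProb
  rw [← (Fin.appendEquiv (α := Bool) (0 + 1) n).sum_comp, Fintype.sum_prod_type]
  rw [Finset.sum_eq_single (fun _ => true)]
  · refine Finset.sum_congr rfl fun w _ => ?_
    simp only [Fin.appendEquiv, Equiv.coe_fn_mk]
    rw [hfinal]
    exact if_pos (append_zero n _ w)
  · intro u _ hu
    have hu0 : ¬ u 0 = true := by
      refine fun h => hu (funext fun i => ?_)
      obtain rfl : i = 0 := Fin.ext (Nat.lt_one_iff.mp i.isLt)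
      exact h
    refine Finset.sum_eq_zero fun w _ => ?_
    simp only [Fin.appendEquiv, Equiv.coe_fn_mk]
    exact if_neg fun h => hu0 ((append_zero n u w).symm.trans h)
  · simp

theorem acceptProb_flipTester_of_eq_one (n : ℕ) (O : QuantumOracle) (hO : O n = 1)
    (ψ : QState n) : (flipTester n).acceptProb O ψ = 0 := by
  rw [acceptProb_flipTester n O (fun _ => 1) (by rw [hO]; exact Matrix.diagonal_one.symm)]
  simp

theorem acceptProb_flipTester_of_eq_phaseFlip (n : ℕ) (O : QuantumOracle) (y : Fin n → Bool)
    (hO : O n = phaseFlip y) (ψ : QState n) :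
    (flipTester n).acceptProb O ψ = ‖ψ y‖ ^ 2 := by
  rw [acceptProb_flipTester n O (fun x => if x = y then -1 else 1) (by rw [hO]; rfl)]
  rw [Finset.sum_eq_single y]
  · norm_num
  · intro w _ hw
    simp [hw]
  · simp

namespace OracleCircuit

theorem bddAbove_witnessDim (C : OracleCircuit) (O : QuantumOracle) (a : ℝ) :
    BddAbove {d : ℕ | ∃ W : Submodule ℂ (QState C.wit), Module.finrank ℂ W = d ∧
      ∀ ψ ∈ W, ψ.IsUnit → a ≤ C.acceptProb O ψ} := by
  refine ⟨Module.finrank ℂ (QState C.wit), ?_⟩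
  rintro d ⟨W, rfl, -⟩
  exact Submodule.finrank_le W

theorem le_witnessDim (C : OracleCircuit) (O : QuantumOracle) (a : ℝ)
    (W : Submodule ℂ (QState C.wit))
    (hW : ∀ ψ ∈ W, ψ.IsUnit → a ≤ C.acceptProb O ψ) :
    Module.finrank ℂ W ≤ C.witnessDim O a :=
  le_csSup (C.bddAbove_witnessDim O a) ⟨W, rfl, hW⟩

/-- A nonzero vector of an admissible subspace could be normalised to a witness accepted with
probability at least `a`, so only the zero subspace is admissible. -/
theorem witnessDim_eq_zero (C : OracleCircuit) (O : QuantumOracle) (a : ℝ)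
    (h : ∀ ψ : QState C.wit, ψ.IsUnit → C.acceptProb O ψ < a) : C.witnessDim O a = 0 := by
  refine Nat.le_zero.mp (csSup_le' ?_)
  rintro d ⟨W, rfl, hW⟩
  rw [Nat.le_zero, Submodule.finrank_eq_zero, Submodule.eq_bot_iff]
  intro φ hφ
  by_contra hne
  have hpos : φ.nrm ≠ 0 := by
    rw [QState.nrm, norm_ne_zero_iff]
    simpa using hne
  have hunit : QState.IsUnit (((φ.nrm⁻¹ : ℝ) : ℂ) • φ) := by
    have : ∀ x, ‖((((φ.nrm⁻¹ : ℝ) : ℂ) • φ) : QState C.wit) x‖ ^ 2 =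
        (φ.nrm⁻¹) ^ 2 * ‖φ x‖ ^ 2 := by
      intro x
      rw [Pi.smul_apply, norm_smul, mul_pow, Complex.norm_real, Real.norm_eq_abs, sq_abs]
    simp only [QState.IsUnit, this]
    rw [← Finset.mul_sum, ← QState.nrm_sq, ← mul_pow, inv_mul_cancel₀ hpos, one_pow]
  exact absurd (hW _ (W.smul_mem _ hφ) hunit) (not_le.mpr (h _ hunit))

end OracleCircuit

/-- The approximate counting instance that decides whether the oracle on `n` qubits flips a
phase. -/
abbrev flipQuery (n : ℕ) : CountingQuery where
  circ := flipTester n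
  a := 1
  b := 1 / 2
  ε := 1 / 2
  cut := 0
  small := true

theorem phaseFlip_ne_one {n : ℕ} (y : Fin n → Bool) : phaseFlip y ≠ 1 := by
  intro h
  have h1 := congrArg (fun U : Matrix.unitaryGroup (Fin n → Bool) ℂ => U.1 y y) h
  simp only [phaseFlip, Matrix.diagonal_apply_eq, if_true] at h1
  have h2 : (-1 : ℂ) = 1 := by simpa using h1
  norm_num at h2

/-- Deciding whether the oracle acts trivially, or flips a phase, on as many qubits as there are
bits in the input. -/
def flipProblem (O : QuantumOracle) : PromiseProblem where
  yes := {x | O x.length = 1}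
  no := {x | ∃ y : Fin x.length → Bool, O x.length = phaseFlip y}
  disjoint := by
    rw [Set.disjoint_left]
    rintro x hx ⟨y, hy⟩
    exact phaseFlip_ne_one y (hy.symm.trans hx)

theorem flipQuery_answer_of_eq_one (O : QuantumOracle) (n : ℕ) (hO : O n = 1) (D : ℝ)
    (hD : (flipQuery n).IsEstimate O D) : (flipQuery n).Answer D := by
  have h := hD.2
  have h0 : (flipQuery n).circ.witnessDim O ((flipQuery n).b : ℝ) = 0 := by
    refine OracleCircuit.witnessDim_eq_zero _ _ _ fun ψ _ => ?_
    rw [acceptProb_flipTester_of_eq_one n O hO]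
    norm_num [flipQuery]
  rw [h0] at h
  simpa [CountingQuery.Answer, flipQuery] using h

/-- The basis state `y` is accepted with certainty, so the line it spans gives `D_1 ≥ 1` and every
valid estimate is at least `1/2`, above the cut `0`. -/
theorem flipQuery_not_answer_of_eq_phaseFlip (O : QuantumOracle) (n : ℕ) (y : Fin n → Bool)
    (hO : O n = phaseFlip y) (D : ℝ) (hD : (flipQuery n).IsEstimate O D) :
    ¬ (flipQuery n).Answer D := by
  have h := hD.1
  have h1 : 1 ≤ (flipQuery n).circ.witnessDim O ((flipQuery n).a : ℝ) := by
    have hne : (Pi.single y 1 : QState n) ≠ 0 := by simp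
    have hle := OracleCircuit.le_witnessDim (flipTester n) O ((flipQuery n).a : ℝ)
      (ℂ ∙ (Pi.single y 1 : QState n)) ?_
    · rwa [finrank_span_singleton hne] at hle
    · intro ψ hψ hunit
      rw [acceptProb_flipTester_of_eq_phaseFlip n O y hO]
      obtain ⟨c, rfl⟩ := Submodule.mem_span_singleton.mp hψ
      have : ‖c‖ ^ 2 = 1 := by
        have hu : ∑ x : Fin n → Bool, ‖(c • (Pi.single y 1 : QState n)) x‖ ^ 2 = 1 := hunit
        rw [Finset.sum_eq_single y] at hu
        · simpa using hu
        · intro x _ hx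
          simp [hx]
        · simp
      simp [this]
  have h1' : (1 : ℝ) ≤ ((flipQuery n).circ.witnessDim O ((flipQuery n).a : ℝ) : ℝ) := by
    exact_mod_cast h1
  have hε : (((flipQuery n).ε : ℚ≥0) : ℝ) = 1 / 2 := by norm_num [flipQuery]
  rw [hε] at h
  have key : ∀ X : ℝ, 1 ≤ X → (1 - 1 / 2) * X ≤ D → 0 < D := fun X h2 h3 => by linarith
  simpa [CountingQuery.Answer] using key _ h1' h

theorem flipProblem_mem_QXC (O : QuantumOracle)
    (h : PolyTimeComputable CountingQuery.encode fun x => flipQuery x.length) :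
    flipProblem O ∈ QXC O := by
  -- The constant polynomial `2` suffices because `a - b = ε = 1/2`.
  refine ⟨_, h, ⟨2, fun x _ => ?_⟩, fun x hx D hD => ?_, fun x hx D hD => ?_⟩
  · have h2 : (2 : Polynomial ℕ).eval x.length = 2 := Polynomial.eval_ofNat 2 _
    refine ⟨by simp, ?_, le_rfl, ?_, ?_⟩
    · rw [← NNRat.coe_lt_coe]
      norm_num
    · rw [h2]; norm_num [flipQuery]
    · rw [h2]; norm_num [flipQuery]
  · exact flipQuery_answer_of_eq_one O x.length hx D hD
  · obtain ⟨y, hy⟩ := hx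
    exact flipQuery_not_answer_of_eq_phaseFlip O x.length y hy D hD

/-! ### A polynomial-time machine that writes its input length twice -/

namespace LengthWriter

open Turing Turing.TM2.Stmt

/-- The contents of the three stacks: input, output and scratch. -/
def stk3 (i o s : List Bool) : Fin 3 → List Bool := ![i, o, s]

theorem update_zero (i o s l : List Bool) :
    Function.update (stk3 i o s) 0 l = stk3 l o s := by
  funext k; fin_cases k <;> rfl

theorem update_one (i o s l : List Bool) :
    Function.update (stk3 i o s) 1 l = stk3 i l s := by
  funext k; fin_cases k <;> rfl

theorem update_two (i o s l : List Bool) :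
    Function.update (stk3 i o s) 2 l = stk3 i o l := by
  funext k; fin_cases k <;> rfl

/-- Statements of the machine. -/
abbrev Prog : Type := TM2.Stmt (fun _ : Fin 3 => Bool) (Fin 3) Bool

/-- Put the string `l` on top of the output stack. -/
def pushAll : List Bool → Prog → Prog
  | [], q => q
  | b :: l, q => pushAll l (push 1 (fun _ => b) q)

theorem stepAux_pushAll (l : List Bool) (q : Prog) (v : Bool) (i o s : List Bool) :
    TM2.stepAux (pushAll l q) v (stk3 i o s) = TM2.stepAux q v (stk3 i (l ++ o) s) := by
  induction l generalizing q with
  | nil => rfl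
  | cons b l ih =>
    rw [pushAll, ih, TM2.stepAux, update_one]
    rfl

/-- The program: write `c₃`, copy the input in unary to the output and the scratch stack, write
`c₂`, move the scratch stack to the output, write `c₁`. -/
def prog (c₁ c₂ c₃ : List Bool) : Fin 3 → Prog
  | 0 => pushAll c₃ (goto fun _ => 1)
  | 1 => pop 0 (fun _ o => o.isSome) (branch id
      (push 1 (fun _ => true) (push 2 (fun _ => true) (goto fun _ => 1)))
      (pushAll c₂ (goto fun _ => 2)))
  | 2 => pop 2 (fun _ o => o.isSome) (branch id
      (push 1 (fun _ => true) (goto fun _ => 2))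
      (pushAll c₁ halt))

/-- The machine with the program `prog`. -/
def machine (c₁ c₂ c₃ : List Bool) : FinTM2 where
  K := Fin 3
  k₀ := 0
  k₁ := 1
  Γ := fun _ => Bool
  Λ := Fin 3
  main := 0
  σ := Bool
  initialState := false
  m := prog c₁ c₂ c₃

/-- Configurations of the machine. -/
def cfg (l : Option (Fin 3)) (v : Bool) (i o s : List Bool) :
    TM2.Cfg (fun _ : Fin 3 => Bool) (Fin 3) Bool := ⟨l, v, stk3 i o s⟩

variable (c₁ c₂ c₃ : List Bool)

theorem step_zero (v : Bool) (i o s : List Bool) :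
    TM2.step (prog c₁ c₂ c₃) (cfg (some 0) v i o s) = some (cfg (some 1) v i (c₃ ++ o) s) := by
  simp only [cfg, TM2.step, prog, stepAux_pushAll]
  rfl

theorem step_one_cons (v b : Bool) (i o s : List Bool) :
    TM2.step (prog c₁ c₂ c₃) (cfg (some 1) v (b :: i) o s) =
      some (cfg (some 1) true i (true :: o) (true :: s)) := by
  simp only [cfg, TM2.step, prog, TM2.stepAux, update_zero, update_one, update_two]
  rfl

theorem step_one_nil (v : Bool) (o s : List Bool) :
    TM2.step (prog c₁ c₂ c₃) (cfg (some 1) v [] o s) =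
      some (cfg (some 2) false [] (c₂ ++ o) s) := by
  simp only [cfg, TM2.step, prog, TM2.stepAux, update_zero, update_one, update_two]
  exact congrArg some (stepAux_pushAll c₂ _ _ _ _ _)

theorem step_two_cons (v b : Bool) (o s : List Bool) :
    TM2.step (prog c₁ c₂ c₃) (cfg (some 2) v [] o (b :: s)) =
      some (cfg (some 2) true [] (true :: o) s) := by
  simp only [cfg, TM2.step, prog, TM2.stepAux, update_one, update_two]
  rfl

theorem step_two_nil (v : Bool) (o : List Bool) :
    TM2.step (prog c₁ c₂ c₃) (cfg (some 2) v [] o []) =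
      some (cfg none false [] (c₁ ++ o) []) := by
  simp only [cfg, TM2.step, prog, TM2.stepAux, update_one, update_two]
  exact congrArg some (stepAux_pushAll c₁ _ _ _ _ _)

theorem iterate_two (v : Bool) (o s : List Bool) :
    (flip bind (TM2.step (prog c₁ c₂ c₃)))^[s.length + 1] (some (cfg (some 2) v [] o s)) =
      some (cfg none false [] (c₁ ++ (List.replicate s.length true ++ o)) []) := by
  induction s generalizing v o with
  | nil => exact step_two_nil c₁ c₂ c₃ v o
  | cons b s ih =>
    rw [List.length_cons, Function.iterate_succ_apply]
    have : flip bind (TM2.step (prog c₁ c₂ c₃)) (some (cfg (some 2) v [] o (b :: s))) = _ :=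
      step_two_cons c₁ c₂ c₃ v b o s
    rw [this, ih, List.replicate_succ', List.append_assoc]
    rfl

/-- The parameter `n` counts the marks already on the scratch stack, which makes the induction on
the input go through. The exponent adds the durations of the copying loop and of the emptying loop.
-/
theorem iterate_one (v : Bool) (i o : List Bool) (n : ℕ) :
    (flip bind (TM2.step (prog c₁ c₂ c₃)))^[i.length + 1 + (n + i.length + 1)]
      (some (cfg (some 1) v i o (List.replicate n true))) =
      some (cfg none false [] (c₁ ++ (List.replicate (n + i.length) true ++
        (c₂ ++ (List.replicate i.length true ++ o)))) []) := by
  induction i generalizing v o n with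
  | nil =>
    rw [List.length_nil, zero_add, Nat.add_comm 1, Function.iterate_succ_apply]
    have : flip bind (TM2.step (prog c₁ c₂ c₃))
      (some (cfg (some 1) v [] o (List.replicate n true))) = _ :=
      step_one_nil c₁ c₂ c₃ v o (List.replicate n true)
    have h := iterate_two c₁ c₂ c₃ false (c₂ ++ o) (List.replicate n true)
    rw [List.length_replicate] at h
    rw [this]
    exact h
  | cons b i ih =>
    have hn : (b :: i).length + 1 + (n + (b :: i).length + 1) =
        (i.length + 1 + (n + 1 + i.length + 1)) + 1 := by simp only [List.length_cons]; omega
    rw [hn, Function.iterate_succ_apply]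
    have : flip bind (TM2.step (prog c₁ c₂ c₃))
      (some (cfg (some 1) v (b :: i) o (List.replicate n true))) = _ :=
      step_one_cons c₁ c₂ c₃ v b i o (List.replicate n true)
    rw [this, ← List.replicate_succ, ih]
    have e1 : n + 1 + i.length = n + (b :: i).length := by simp only [List.length_cons]; omega
    rw [e1, List.length_cons, List.replicate_succ' (n := i.length)]
    simp

theorem iterate_machine (x : List Bool) :
    (flip bind (TM2.step (prog c₁ c₂ c₃)))^[2 * x.length + 3] (some (cfg (some 0) false x [] [])) =
      some (cfg none false [] (c₁ ++ (List.replicate x.length true ++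
        (c₂ ++ (List.replicate x.length true ++ c₃)))) []) := by
  have hn : 2 * x.length + 3 = (x.length + 1 + (0 + x.length + 1)) + 1 := by omega
  rw [hn, Function.iterate_succ_apply]
  have : flip bind (TM2.step (prog c₁ c₂ c₃)) (some (cfg (some 0) false x [] [])) = _ :=
    step_zero c₁ c₂ c₃ false x [] []
  rw [this]
  have h := iterate_one c₁ c₂ c₃ false x (c₃ ++ []) 0
  rw [zero_add, List.append_nil] at h
  rw [List.append_nil, zero_add]
  exact h

/-- Two unary copies are what `flipQuery` needs: `n` occurs once as the number of witness wires and
once as the size of the query. Output is pushed from its end, so `c₃` is written first. -/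
theorem polyTimeComputable {β : Type} (enc : β → List Bool) (f : List Bool → β)
    (h : ∀ x, enc (f x) = c₁ ++ (List.replicate x.length true ++
      (c₂ ++ (List.replicate x.length true ++ c₃)))) : PolyTimeComputable enc f := by
  refine ⟨{
    tm := machine c₁ c₂ c₃
    inputAlphabet := Equiv.refl Bool
    outputAlphabet := Equiv.refl Bool
    time := 2 * Polynomial.X + 3
    outputsFun := fun x =>
      { steps := 2 * x.length + 3
        evals_in_steps := ?_
        steps_le_m := by simp } }, fun _ => Finite.of_fintype Bool⟩
  have hin : initList (machine c₁ c₂ c₃) (List.map (Equiv.refl Bool).invFun (id x)) =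
      cfg (some 0) false x [] [] := by
    unfold initList cfg
    congr 1
    funext (k : Fin 3)
    fin_cases k
    · exact List.map_id x
    · rfl
    · rfl
  have hout : ∀ y, haltList (machine c₁ c₂ c₃) (List.map (Equiv.refl Bool).invFun y) =
      cfg none false [] y [] := by
    intro y
    unfold haltList cfg
    congr 1
    funext (k : Fin 3)
    fin_cases k
    · rfl
    · exact List.map_id y
    · rfl
  rw [hin, Option.map_some, hout, h]
  exact iterate_machine c₁ c₂ c₃ x

end LengthWriter

/-! ### There are countably many polynomial-time computable functions -/

/-- On finite alphabets and state sets each local function of a machine is a finite table. Coding it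
by a finitely supported function on numbers leaves only countably many possibilities. -/
theorem exists_finsupp_extend {α β : Type*} [Finite α] {e : α → β} (he : Function.Injective e)
    (f : α → ℕ) : ∃ t : β →₀ ℕ, ∀ a, t (e a) = f a :=
  ⟨(Finsupp.equivFunOnFinite.symm f).embDomain ⟨e, he⟩, fun a => by
    simpa using Finsupp.embDomain_apply_self ⟨e, he⟩ (Finsupp.equivFunOnFinite.symm f) a⟩

namespace Turing.TM2

/-- Statements of multi-stack machines over natural numbers that are given by finite data. -/
inductive StmtCode : Type
  | push (k : ℕ) (f : ℕ →₀ ℕ) (q : StmtCode)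
  | peek (k : ℕ) (f : ℕ × Option ℕ →₀ ℕ) (q : StmtCode)
  | pop (k : ℕ) (f : ℕ × Option ℕ →₀ ℕ) (q : StmtCode)
  | load (f : ℕ →₀ ℕ) (q : StmtCode)
  | branch (f : ℕ →₀ ℕ) (q₁ q₂ : StmtCode)
  | goto (f : ℕ →₀ ℕ)
  | halt
  deriving Countable

/-- The statement described by a code. -/
def StmtCode.toStmt : StmtCode → Stmt (fun _ : ℕ => ℕ) ℕ ℕ
  | push k f q => .push k f q.toStmt
  | peek k f q => .peek k (fun v o => f (v, o)) q.toStmt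
  | pop k f q => .pop k (fun v o => f (v, o)) q.toStmt
  | load f q => .load f q.toStmt
  | branch f q₁ q₂ => .branch (fun v => decide (f v = 1)) q₁.toStmt q₂.toStmt
  | goto f => .goto f
  | halt => .halt

section Simulation

variable {K : Type*} {Γ : K → Type*} {Λ σ : Type*}
  (eK : K → ℕ) (eΓ : ∀ k, Γ k → ℕ) (eΛ : Λ → ℕ) (eσ : σ → ℕ)

/-- The stacks `S'` over natural numbers represent the stacks `S`. -/
def StackRel (S : ∀ k, List (Γ k)) (S' : ℕ → List ℕ) : Prop :=
  ∀ k, S' (eK k) = (S k).map (eΓ k)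

/-- The configuration `c'` over natural numbers represents the configuration `c`. -/
def CfgRel (c : Cfg Γ Λ σ) (c' : Cfg (fun _ : ℕ => ℕ) ℕ ℕ) : Prop :=
  c'.l = c.l.map eΛ ∧ c'.var = eσ c.var ∧ StackRel eK eΓ c.stk c'.stk

variable {eK eΓ eΛ eσ}

theorem StackRel.update [DecidableEq K] (hK : Function.Injective eK) {S : ∀ k, List (Γ k)}
    {S' : ℕ → List ℕ} (h : StackRel eK eΓ S S') (k : K) {l : List (Γ k)} {l' : List ℕ}
    (hl : l' = l.map (eΓ k)) :
    StackRel eK eΓ (Function.update S k l) (Function.update S' (eK k) l') := by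
  intro j
  by_cases hj : j = k
  · subst hj
    simp [hl]
  · rw [Function.update_of_ne hj, Function.update_of_ne (hK.ne hj), h j]

theorem exists_stmtCode [DecidableEq K] [∀ k, Finite (Γ k)] [Finite σ]
    (hK : Function.Injective eK) (hΓ : ∀ k, Function.Injective (eΓ k))
    (hσ : Function.Injective eσ) (q : Stmt Γ Λ σ) :
    ∃ c : StmtCode, ∀ v S S', StackRel eK eΓ S S' →
      CfgRel eK eΓ eΛ eσ (stepAux q v S) (stepAux c.toStmt (eσ v) S') := by
  -- `peek` and `pop` depend only on the state and the top symbol, a finite set of pairs.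
  have table : ∀ (k : K) (f : σ → Option (Γ k) → σ), ∃ t : ℕ × Option ℕ →₀ ℕ,
      ∀ v S S', StackRel eK eΓ S S' → t (eσ v, (S' (eK k)).head?) = eσ (f v (S k).head?) := by
    intro k f
    obtain ⟨t, ht⟩ := exists_finsupp_extend (hσ.prodMap (Option.map_injective (hΓ k)))
      (fun p => eσ (f p.1 p.2))
    refine ⟨t, fun v S S' h => ?_⟩
    rw [← ht (v, (S k).head?), h k, List.head?_map]
    rfl
  induction q with
  | push k f q ih =>
    obtain ⟨c, hc⟩ := ih
    obtain ⟨t, ht⟩ := exists_finsupp_extend hσ (fun v => eΓ k (f v))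
    exact ⟨.push (eK k) t c, fun v S S' h => hc _ _ _ (h.update hK k (by simp [ht, h k]))⟩
  | peek k f q ih =>
    obtain ⟨c, hc⟩ := ih
    obtain ⟨t, ht⟩ := table k f
    refine ⟨.peek (eK k) t c, fun v S S' h => ?_⟩
    simp only [StmtCode.toStmt, stepAux, ht v S S' h]
    exact hc _ _ _ h
  | pop k f q ih =>
    obtain ⟨c, hc⟩ := ih
    obtain ⟨t, ht⟩ := table k f
    refine ⟨.pop (eK k) t c, fun v S S' h => ?_⟩
    simp only [StmtCode.toStmt, stepAux, ht v S S' h]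
    exact hc _ _ _ (h.update hK k (by simp [h k]))
  | load f q ih =>
    obtain ⟨c, hc⟩ := ih
    obtain ⟨t, ht⟩ := exists_finsupp_extend hσ (fun v => eσ (f v))
    refine ⟨.load t c, fun v S S' h => ?_⟩
    simp only [StmtCode.toStmt, stepAux, ht]
    exact hc _ _ _ h
  | branch f q₁ q₂ ih₁ ih₂ =>
    obtain ⟨c₁, hc₁⟩ := ih₁
    obtain ⟨c₂, hc₂⟩ := ih₂
    obtain ⟨t, ht⟩ := exists_finsupp_extend hσ (fun v => (f v).toNat)
    refine ⟨.branch t c₁ c₂, fun v S S' h => ?_⟩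
    have : decide (t (eσ v) = 1) = f v := by rw [ht]; cases f v <;> rfl
    simp only [StmtCode.toStmt, stepAux, this]
    cases f v
    · exact hc₂ _ _ _ h
    · exact hc₁ _ _ _ h
  | goto f =>
    obtain ⟨t, ht⟩ := exists_finsupp_extend hσ (fun v => eΛ (f v))
    exact ⟨.goto t, fun v S S' h => ⟨by simp [StmtCode.toStmt, ht], rfl, h⟩⟩
  | halt => exact ⟨.halt, fun v S S' h => ⟨rfl, rfl, h⟩⟩

/-- The program described by a list of codes. -/
def progOfCodes (p : List StmtCode) (l : ℕ) : Stmt (fun _ : ℕ => ℕ) ℕ ℕ :=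
  (p.getD l .halt).toStmt

theorem iterate_bind_none {α : Type*} (f : α → Option α) (n : ℕ) :
    (flip bind f)^[n] none = none :=
  Function.iterate_fixed rfl n

/-- Numbering the finitely many labels turns the program into a list of codes. A single list
simulates all runs, whatever the input and the running time. -/
theorem exists_progOfCodes [DecidableEq K] [∀ k, Finite (Γ k)] [Finite σ] {n : ℕ} (e : Λ ≃ Fin n)
    (hK : Function.Injective eK) (hΓ : ∀ k, Function.Injective (eΓ k))
    (hσ : Function.Injective eσ) (m : Λ → Stmt Γ Λ σ) :
    ∃ p : List StmtCode, ∀ t c c' d, CfgRel eK eΓ (fun l => (e l : ℕ)) eσ c c' →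
      (flip bind (step m))^[t] (some c) = some d →
      ∃ d', (flip bind (step (progOfCodes p)))^[t] (some c') = some d' ∧
        CfgRel eK eΓ (fun l => (e l : ℕ)) eσ d d' := by
  choose code hcode using fun l => exists_stmtCode (eΛ := fun l => (e l : ℕ)) hK hΓ hσ (m l)
  refine ⟨List.ofFn fun i => code (e.symm i), fun t => ?_⟩
  induction t with
  | zero =>
    intro c c' d h hd
    obtain rfl : c = d := by simpa using hd
    exact ⟨c', rfl, h⟩
  | succ t ih =>
    rintro ⟨l, v, S⟩ ⟨l', v', S'⟩ d ⟨h1, h2, h3⟩ hd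
    simp only at h1 h2 h3
    subst h1 h2
    rw [Function.iterate_succ_apply] at hd ⊢
    cases l with
    | none =>
      have : flip bind (step m) (some ⟨none, v, S⟩) = none := rfl
      rw [this, iterate_bind_none] at hd
      cases hd
    | some l =>
      refine ih _ _ _ ?_ hd
      have : progOfCodes (List.ofFn fun i => code (e.symm i)) (e l) = (code l).toStmt := by
        simp [progOfCodes]
      simp only [this]
      exact hcode l v S S' h3

/-- A halted configuration has no successor, so a later iterate is `none`, and a deterministic run
reaches a halted configuration at one time only. -/
theorem eq_of_iterate_eq_halted {f : Cfg Γ Λ σ → Option (Cfg Γ Λ σ)} {a b c : Cfg Γ Λ σ}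
    (hf : ∀ d : Cfg Γ Λ σ, d.l = none → f d = none) (hb : b.l = none) (hc : c.l = none) {m n : ℕ}
    (h1 : (flip bind f)^[m] (some a) = some b) (h2 : (flip bind f)^[n] (some a) = some c) :
    b = c := by
  wlog hmn : m ≤ n generalizing b c m n
  · exact (this hc hb h2 h1 (by omega)).symm
  obtain ⟨k, rfl⟩ := Nat.exists_eq_add_of_le' hmn
  rw [Function.iterate_add_apply, h1] at h2
  cases k with
  | zero => simpa using h2
  | succ k =>
    have : flip bind f (some b) = none := hf b hb
    rw [Function.iterate_succ_apply, this, iterate_bind_none] at h2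
    cases h2

end Simulation

/-- A multi-stack machine over natural numbers, with input and output alphabets, that is given by
finite data. -/
structure MachineCode : Type where
  input : ℕ
  output : ℕ
  main : ℕ
  state : ℕ
  inputSymbol : Bool → ℕ
  outputSymbol : Bool → ℕ
  prog : List StmtCode
  deriving Countable

/-- The initial configuration on the input `x`. -/
def MachineCode.init (M : MachineCode) (x : List Bool) : Cfg (fun _ : ℕ => ℕ) ℕ ℕ :=
  ⟨some M.main, M.state, fun k => if k = M.input then x.map M.inputSymbol else []⟩

/-- The machine described by `M` computes `f`. -/
def MachineCode.Computes (M : MachineCode) (f : List Bool → List Bool) : Prop :=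
  Function.Injective M.outputSymbol ∧ ∀ x, ∃ t c,
    (flip bind (step (progOfCodes M.prog)))^[t] (some (M.init x)) = some c ∧
      c.l = none ∧ c.stk M.output = (f x).map M.outputSymbol

theorem MachineCode.Computes.unique {M : MachineCode} {f g : List Bool → List Bool}
    (hf : M.Computes f) (hg : M.Computes g) : f = g := by
  funext x
  obtain ⟨s, c, h1, h2, h3⟩ := hf.2 x
  obtain ⟨t, d, h4, h5, h6⟩ := hg.2 x
  have hstep : ∀ d : Cfg (fun _ : ℕ => ℕ) ℕ ℕ, d.l = none →
      step (progOfCodes M.prog) d = none := by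
    rintro ⟨l, v, S⟩ rfl
    rfl
  obtain rfl := eq_of_iterate_eq_halted hstep h2 h5 h1 h4
  exact List.map_injective_iff.mpr hf.1 (h3.symm.trans h6)

end Turing.TM2

open Turing Turing.TM2 in
theorem PolyTimeComputable.exists_machineCode {β : Type} {enc : β → List Bool}
    {f : List Bool → β} (h : PolyTimeComputable enc f) :
    ∃ M : MachineCode, M.Computes fun x => enc (f x) := by
  obtain ⟨M, hfin⟩ := h
  have := M.tm.kFin
  have := M.tm.ΛFin
  have := M.tm.σFin
  choose eΓ hΓ using fun k => exists_injective_nat (M.tm.Γ k)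
  obtain ⟨eK, hK⟩ := exists_injective_nat M.tm.K
  obtain ⟨eσ, hσ⟩ := exists_injective_nat M.tm.σ
  let e := Fintype.equivFin M.tm.Λ
  obtain ⟨p, hp⟩ := exists_progOfCodes e hK hΓ hσ M.tm.m
  let N : MachineCode := ⟨eK M.tm.k₀, eK M.tm.k₁, e M.tm.main, eσ M.tm.initialState,
    fun b => eΓ _ (M.inputAlphabet.symm b), fun b => eΓ _ (M.outputAlphabet.symm b), p⟩
  refine ⟨N, (hΓ _).comp M.outputAlphabet.symm.injective, fun x => ?_⟩
  obtain ⟨⟨t, ht⟩, -⟩ := M.outputsFun x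
  have hinit : CfgRel eK eΓ (fun l => (e l : ℕ)) eσ
      (initList M.tm (List.map M.inputAlphabet.invFun (id x))) (N.init x) := by
    refine ⟨rfl, rfl, fun k => ?_⟩
    by_cases hk : k = M.tm.k₀
    · subst hk
      simp only [MachineCode.init, N, initList, dite_true, if_true, eq_mpr_eq_cast, cast_eq,
        List.map_map, id]
      rfl
    · simp [MachineCode.init, N, initList, hk, hK.ne hk]
  obtain ⟨c, hc, hl, -, hs⟩ := hp t _ _
    (haltList M.tm (List.map M.outputAlphabet.invFun (enc (f x)))) hinit ht
  refine ⟨t, c, hc, hl, ?_⟩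
  have := hs M.tm.k₁
  simp only [haltList, dite_true, eq_mpr_eq_cast, cast_eq, List.map_map] at this
  exact this

/-- A code, being deterministic, computes at most one function, and `enc` is injective, so choosing
a code for each function is an injection into a countable type. -/
theorem countable_setOf_polyTimeComputable {β : Type} {enc : β → List Bool}
    (henc : Function.Injective enc) : {f : List Bool → β | PolyTimeComputable enc f}.Countable := by
  choose M hM using fun f : {f : List Bool → β | PolyTimeComputable enc f} =>
    PolyTimeComputable.exists_machineCode f.2
  refine Function.Injective.countable (f := M) fun f g hfg => ?_
  have h := (hM f).unique (hfg ▸ hM g)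
  exact Subtype.ext (funext fun x => henc (congrFun h x))

/-! ### Outputs of polynomial-time computable functions are short -/

namespace Turing.TM2

variable {K : Type*} {Γ : K → Type*} {Λ σ : Type*}

/-- A bound for the number of symbols that a statement pushes. -/
def Stmt.pushBound : Stmt Γ Λ σ → ℕ
  | .push _ _ q => q.pushBound + 1
  | .peek _ _ q => q.pushBound
  | .pop _ _ q => q.pushBound
  | .load _ q => q.pushBound
  | .branch _ q₁ q₂ => max q₁.pushBound q₂.pushBound
  | .goto _ => 0
  | .halt => 0

theorem length_update_tail_le [DecidableEq K] (S : ∀ k, List (Γ k)) (j k : K) :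
    ((Function.update S j (S j).tail) k).length ≤ (S k).length := by
  by_cases h : k = j
  · subst h; simp
  · simp [Function.update_of_ne h]

theorem length_update_cons_le [DecidableEq K] (S : ∀ k, List (Γ k)) (j k : K) (a : Γ j) :
    ((Function.update S j (a :: S j)) k).length ≤ (S k).length + 1 := by
  by_cases h : k = j
  · subst h; simp
  · simp [Function.update_of_ne h]

theorem length_stk_stepAux_le [DecidableEq K] (q : Stmt Γ Λ σ) (v : σ) (S : ∀ k, List (Γ k))
    (k : K) : ((stepAux q v S).stk k).length ≤ (S k).length + q.pushBound := by
  induction q generalizing v S with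
  | push j f q ih =>
    have h1 := ih v (Function.update S j (f v :: S j))
    have h2 := length_update_cons_le S j k (f v)
    simp only [stepAux, Stmt.pushBound]
    omega
  | peek j f q ih => exact ih _ _
  | pop j f q ih => exact (ih _ _).trans (Nat.add_le_add_right (length_update_tail_le S j k) _)
  | load f q ih => exact ih _ _
  | branch f q₁ q₂ ih₁ ih₂ =>
    have h1 := ih₁ v S
    have h2 := ih₂ v S
    simp only [stepAux, Stmt.pushBound]
    cases f v
    · exact h2.trans (Nat.add_le_add_left (le_max_right _ _) _)
    · exact h1.trans (Nat.add_le_add_left (le_max_left _ _) _)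
  | goto f => exact le_rfl
  | halt => exact le_rfl

theorem length_stk_iterate_le [DecidableEq K] {m : Λ → Stmt Γ Λ σ} {B : ℕ}
    (hB : ∀ l, (m l).pushBound ≤ B) (k : K) (t : ℕ) (c d : Cfg Γ Λ σ)
    (h : (flip bind (step m))^[t] (some c) = some d) :
    (d.stk k).length ≤ (c.stk k).length + t * B := by
  induction t generalizing d with
  | zero =>
    obtain rfl : c = d := by simpa using h
    simp
  | succ t ih =>
    rw [Function.iterate_succ_apply'] at h
    cases hc : (flip bind (step m))^[t] (some c) with
    | none => rw [hc] at h; cases h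
    | some c' =>
      rw [hc] at h
      have h1 := ih c' hc
      obtain ⟨l, v, S⟩ := c'
      cases l with
      | none => cases h
      | some l =>
        obtain rfl : stepAux (m l) v S = d := Option.some.inj h
        have h2 := length_stk_stepAux_le (m l) v S k
        have h3 := hB l
        simp only at h1
        rw [Nat.succ_mul]
        omega

end Turing.TM2

open Turing Turing.TM2 in
theorem PolyTimeComputable.exists_length_le {β : Type} {enc : β → List Bool}
    {f : List Bool → β} (h : PolyTimeComputable enc f) :
    ∃ p : Polynomial ℕ, ∀ x, (enc (f x)).length ≤ p.eval x.length := by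
  obtain ⟨M, -⟩ := h
  have := M.tm.ΛFin
  obtain ⟨B, hB⟩ := (Set.finite_range fun l => (M.tm.m l).pushBound).bddAbove
  -- A stack starts with at most `|x|` symbols and gains at most `B` per step, `B` being uniform
  -- over the finitely many labels.
  refine ⟨Polynomial.X + M.time * Polynomial.C B, fun x => ?_⟩
  obtain ⟨⟨t, ht⟩, htime⟩ := M.outputsFun x
  have h := length_stk_iterate_le (fun l => hB ⟨l, rfl⟩) M.tm.k₁ t _ _ ht
  have h1 : ((haltList M.tm (List.map M.outputAlphabet.invFun (enc (f x)))).stk M.tm.k₁).length =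
      (enc (f x)).length := by simp [haltList]
  have h2 : ((initList M.tm (List.map M.inputAlphabet.invFun (id x))).stk M.tm.k₁).length ≤
      x.length := by
    by_cases hk : M.tm.k₁ = M.tm.k₀
    · have key : ∀ (k : M.tm.K) (h : k = M.tm.k₀),
          ((initList M.tm (List.map M.inputAlphabet.invFun (id x))).stk k).length ≤ x.length := by
        rintro k rfl
        simp [initList]
      exact key _ hk
    · simp [initList, hk]
  simp only [Polynomial.eval_add, Polynomial.eval_mul, Polynomial.eval_X, Polynomial.eval_C]
  have h3 : t * B ≤ M.time.eval x.length * B := Nat.mul_le_mul_right B htime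
  rw [← h1]
  exact h.trans (Nat.add_le_add h2 h3)

theorem OracleCircuit.length_gates_le (C : OracleCircuit) : C.gates.length ≤ C.encode.length := by
  have key : ∀ gs : List (Gate (C.anc + 1 + C.wit)),
      gs.length ≤ (gs.flatMap Gate.encode).length := by
    intro gs
    induction gs with
    | nil => simp
    | cons g gs ih =>
      have := List.length_pos_iff.mpr g.encode_ne_nil
      simp only [List.flatMap_cons, List.length_append, List.length_cons]
      omega
  have := key C.gates
  simp only [OracleCircuit.encode, List.length_append]
  omega

theorem Polynomial.exists_eval_lt_two_pow (p : Polynomial ℕ) (N : ℕ) :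
    ∃ n, N < n ∧ p.eval n < 2 ^ n := by
  have h : Filter.Tendsto (fun n : ℕ => ((p.eval n : ℕ) : ℝ) / 2 ^ n) Filter.atTop (nhds 0) := by
    simp only [Polynomial.eval_eq_sum_range, Nat.cast_sum, Nat.cast_mul, Nat.cast_pow,
      Finset.sum_div, mul_div_assoc]
    rw [show nhds (0 : ℝ) = nhds (∑ _i ∈ Finset.range (p.natDegree + 1), (0 : ℝ)) by simp]
    refine tendsto_finsetSum _ fun i _ => ?_
    simpa using (tendsto_pow_const_div_const_pow_of_one_lt i (one_lt_two (α := ℝ))).const_mul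
      ((p.coeff i : ℕ) : ℝ)
  obtain ⟨n, hn, hN⟩ :=
    ((h.eventually (gt_mem_nhds one_pos)).and (Filter.eventually_gt_atTop N)).exists
  refine ⟨n, hN, ?_⟩
  rw [div_lt_one (by positivity)] at hn
  exact_mod_cast hn

/-! ### Finite extensions -/

/-- Countably many properties of sequences of finite choices, each of which is witnessed by an
initial segment and can be brought about after any initial segment, hold simultaneously. -/
theorem exists_forall_of_finite_extension {X : ℕ → Type*} [∀ n, Finite (X n)]
    [∀ n, Nonempty (X n)] {ι : Type*} [Countable ι] (P : ι → (∀ n, X n) → Prop)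
    (hlocal : ∀ i, ∀ a : ∀ n, X n, P i a → ∃ N, ∀ b : ∀ n, X n, (∀ n ≤ N, b n = a n) → P i b)
    (hextend : ∀ i, ∀ a : ∀ n, X n, ∀ N, ∃ b : ∀ n, X n, (∀ n ≤ N, b n = a n) ∧ P i b) : ∃ a, ∀ i, P i a := by
  -- Baire category: a product of finite discrete spaces is compact Hausdorff, `hlocal` makes each
  -- property open, and `hextend` makes it dense.
  let _ : ∀ n, TopologicalSpace (X n) := fun _ => ⊥
  have _ : ∀ n, DiscreteTopology (X n) := fun _ => ⟨rfl⟩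
  have hd : Dense (⋂ i, {a | P i a}) := by
    refine dense_iInter_of_isOpen (fun i => ?_) fun i => ?_
    · rw [isOpen_iff_mem_nhds]
      intro a ha
      obtain ⟨N, hN⟩ := hlocal i a ha
      have : (Set.Iic N).pi (fun n => {a n}) ∈ nhds a :=
        set_pi_mem_nhds (Set.finite_Iic N) fun n _ => by simp
      filter_upwards [this] with b hb
      exact hN b fun n hn => hb n hn
    · intro a
      rw [mem_closure_iff_nhds]
      intro U hU
      rw [nhds_pi, Filter.mem_pi] at hU
      obtain ⟨I, hI, t, ht, htU⟩ := hU
      obtain ⟨N, hN⟩ := hI.bddAbove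
      obtain ⟨b, hb, hP⟩ := hextend i a N
      refine ⟨b, htU fun n hn => ?_, hP⟩
      rw [hb n (hN hn)]
      exact mem_of_mem_nhds (ht n)
  obtain ⟨a, ha⟩ := hd.nonempty
  exact ⟨a, fun i => Set.mem_iInter.mp ha i⟩

/-! ### The separation -/

theorem flipQuery_encode (n : ℕ) : (flipQuery n).encode =
    (encodeNNRat 1 ++ encodeNNRat (1 / 2) ++ encodeNNRat (1 / 2) ++ encodeNNRat 0 ++
      [true, false]) ++ (List.replicate n true ++
        ([false, false, false, false, true, true, false, true, false] ++
          (List.replicate n true ++ [false, false, false, false]))) := by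
  simp [CountingQuery.encode, OracleCircuit.encode, Gate.encode, encodeUnary]

theorem polyTimeComputable_flipQuery :
    PolyTimeComputable CountingQuery.encode fun x => flipQuery x.length :=
  LengthWriter.polyTimeComputable _ _ _ _ _ fun x => flipQuery_encode x.length

/-- The oracle that acts trivially or flips a phase, as prescribed for each number of qubits. -/
noncomputable def flipOracle (a : ∀ n : ℕ, Option (Fin n → Bool)) : QuantumOracle :=
  fun n => (a n).elim 1 phaseFlip

theorem flipOracle_update (a : ∀ n : ℕ, Option (Fin n → Bool)) (n : ℕ) (y : Fin n → Bool) :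
    flipOracle (Function.update a n (some y)) =
      Function.update (flipOracle a) n (phaseFlip y) := by
  funext k
  by_cases hk : k = n
  · subst hk
    simp [flipOracle]
  · simp [flipOracle, Function.update_of_ne hk]

/-- The verifiers `V` treat some input `1ⁿ` wrongly, relative to the oracle prescribed by `a`. -/
def FailsAt (V : List Bool → OracleCircuit) (a : ∀ n : ℕ, Option (Fin n → Bool)) (n : ℕ) : Prop :=
  (a n = none ∧ ∀ ψ : QState (V (List.replicate n true)).wit, ψ.IsUnit →
    (V (List.replicate n true)).acceptProb (flipOracle a) ψ < 2 / 3) ∨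
  ((∃ y, a n = some y) ∧ ∃ ψ : QState (V (List.replicate n true)).wit, ψ.IsUnit ∧
    1 / 3 < (V (List.replicate n true)).acceptProb (flipOracle a) ψ)

/-- The circuit on `1ⁿ` is produced without the oracle, so it is fixed, and only oracles on at most
as many qubits as it has wires matter. -/
theorem FailsAt.exists_forall {V : List Bool → OracleCircuit}
    {a : ∀ n : ℕ, Option (Fin n → Bool)} {n : ℕ} (h : FailsAt V a n) :
    ∃ N, ∀ b : ∀ n : ℕ, Option (Fin n → Bool), (∀ k ≤ N, b k = a k) → FailsAt V b n := by
  set C := V (List.replicate n true) with hC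
  refine ⟨max n (C.anc + 1 + C.wit), fun b hb => ?_⟩
  have hacc : ∀ ψ, C.acceptProb (flipOracle b) ψ = C.acceptProb (flipOracle a) ψ :=
    C.acceptProb_congr fun k hk => by
      simp only [flipOracle, hb k (hk.trans (le_max_right _ _))]
  unfold FailsAt
  rw [← hC, hb n (le_max_left _ _)]
  simp only [hacc]
  exact h

/-- Beyond `N` put the identity everywhere and pick a large `n > N`. Either the verifier has no good
witness on the "yes" instance `1ⁿ`, or it has one, and then some flip on `n` qubits yields a "no"
instance on which the same witness is still accepted too often. -/
theorem exists_failsAt_of_extend {V : List Bool → OracleCircuit}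
    (hV : PolyTimeComputable OracleCircuit.encode V) (a : ∀ n : ℕ, Option (Fin n → Bool))
    (N : ℕ) : ∃ b : ∀ n : ℕ, Option (Fin n → Bool), (∀ k ≤ N, b k = a k) ∧ ∃ n, FailsAt V b n := by
  obtain ⟨p, hp⟩ := hV.exists_length_le
  -- `p` bounds the length of the circuit's code and hence its number of gates, so this is the size
  -- condition of the hybrid argument.
  obtain ⟨n, hNn, hn⟩ := Polynomial.exists_eval_lt_two_pow (144 * (p * (p + 1))) N
  let b : ∀ n : ℕ, Option (Fin n → Bool) := fun k => if k ≤ N then a k else none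
  have hb : ∀ k ≤ N, b k = a k := fun k hk => if_pos hk
  have hbn : b n = none := if_neg (by omega)
  set C := V (List.replicate n true) with hC
  by_cases hgood : ∃ ψ : QState C.wit, ψ.IsUnit ∧ 2 / 3 ≤ C.acceptProb (flipOracle b) ψ
  · obtain ⟨ψ, hψ, hacc⟩ := hgood
    have hG : C.gates.length ≤ p.eval n := by
      have := C.length_gates_le.trans (hp (List.replicate n true))
      rwa [List.length_replicate] at this
    have hlt : 144 * (C.gates.length * (C.gates.length + 1)) < 2 ^ n := by
      refine lt_of_le_of_lt ?_ hn
      simp only [Polynomial.eval_mul, Polynomial.eval_add, Polynomial.eval_one,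
        Polynomial.eval_ofNat]
      gcongr
    have hO : flipOracle b n = 1 := by simp [flipOracle, hbn]
    obtain ⟨y, hy⟩ := C.exists_flip_acceptProb_gt (flipOracle b) n hO ψ hψ hacc hlt
    refine ⟨Function.update b n (some y), fun k hk => ?_, n, Or.inr ⟨⟨y, by simp⟩, ψ, hψ, ?_⟩⟩
    · rw [Function.update_of_ne (by omega), hb k hk]
    · rw [flipOracle_update]
      exact hy
  · push Not at hgood
    exact ⟨b, hb, n, Or.inl ⟨hbn, hgood⟩⟩

theorem mainTheorem4 : ∃ O : QuantumOracle, ¬ (QXC O ⊆ QMA O) := by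
  have hcount : Countable {V : List Bool → OracleCircuit |
      PolyTimeComputable OracleCircuit.encode V} :=
    (countable_setOf_polyTimeComputable OracleCircuit.encode_injective).to_subtype
  obtain ⟨a, ha⟩ := exists_forall_of_finite_extension
    (X := fun n => Option (Fin n → Bool))
    (fun (V : {V : List Bool → OracleCircuit | PolyTimeComputable OracleCircuit.encode V}) a =>
      ∃ n, FailsAt V.1 a n)
    (fun V a ⟨n, hn⟩ => hn.exists_forall.imp fun N hN b hb => ⟨n, hN b hb⟩)
    (fun V a N => exists_failsAt_of_extend V.2 a N)
  refine ⟨flipOracle a, fun hsub => ?_⟩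
  obtain ⟨V, hV, hyes, hno⟩ := hsub (flipProblem_mem_QXC _ polyTimeComputable_flipQuery)
  obtain ⟨n, ⟨hn, h⟩ | ⟨⟨y, hn⟩, ψ, hψ, h⟩⟩ := ha ⟨V, hV⟩
  · have hmem : List.replicate n true ∈ (flipProblem (flipOracle a)).yes := by
      change flipOracle a (List.replicate n true).length = 1
      rw [List.length_replicate]
      simp [flipOracle, hn]
    obtain ⟨ψ, hψ, hacc⟩ := hyes _ hmem
    exact absurd hacc (not_le.mpr (h ψ hψ))
  · have hmem : List.replicate n true ∈ (flipProblem (flipOracle a)).no := by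
      change ∃ y, flipOracle a (List.replicate n true).length = phaseFlip y
      rw [List.length_replicate]
      exact ⟨y, by simp [flipOracle, hn]⟩
    exact absurd (hno _ hmem ψ hψ) (not_le.mpr h)
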